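/- Let $V$ be a finite-dimensional complex vector space, let $d\ge 0$ be an integer, let $S^dV$ be the $d$-th symmetric power of $V$, and let $v_d\colon \mathbb P V\to\mathbb P(S^dV)$, $[v]\mapsto[v^d]$, be the Veronese map, with image $X=v_d(\mathbb P V)$. For $r\ge 0$ let $\sigma_r(X)\subset\mathbb P(S^dV)$ be the Zariski closure of the union of the linear spans $\langle y_1,\dots,y_r\rangle$ over all $y_1,\dots,y_r\in X$. For $p\in\mathbb P(S^dV)$ let the rank $R_X(p)$ be the least $r$ such that $p\in\langle y_1,\dots,y_r\rangle$ for some $y_1,\dots,y_r\in X$ (and $\infty$ if there is none), and let the border rank $\underline{R}_X(p)$ be the least $r$ such that $p\in\sigma_r(X)$ (and $\infty$ if there is none). Let $p\in\mathbb P(S^dV)$ and suppose that $R_X(p)\le\frac{d+1}{2}$. Then $R_X(p)=\underline{R}_X(p)$, and, writing $r=R_X(p)$, the expression of $p$ as a sum of $r$ $d$-th powers exists and is unique up to trivialities: for every $w\in S^dV\setminus\{0\}$ with $[w]=p$ there are $v_1,\dots,v_r\in V$ with $w=v_1^d+\dots+v_r^d$, and whenever $w=v_1^d+\dots+v_r^d=v_1'^d+\dots+v_r'^d$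 with all $v_i,v_i'\in V$, there are a permutation $\pi$ of $\{1,\dots,r\}$ and complex numbers $\zeta_1,\dots,\zeta_r$ with $\zeta_i^d=1$ and $v_i'=\zeta_i v_{\pi(i)}$ for all $i$. -/

import Mathlib

open scoped TensorProduct LinearAlgebra.Projectivization

noncomputable section

section Veronese

variable (d : ℕ) {V : Type*} [AddCommGroup V] [Module ℂ V]

/-- The `d`-th power `v ^ d = v ⋯ v` of a vector, in the symmetric power `S^d V`. -/
def symPow (v : V) : Sym[ℂ]^d V :=
  SymmetricPower.tprod ℂ fun _ : Fin d => v

theorem symPow_smul (c : ℂ) (v : V) : symPow d (c • v) = c ^ d • symPow d v := by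
  simpa [symPow] using
    (SymmetricPower.tprod ℂ (ι := Fin d) (M := V)).map_smul_univ (fun _ => c) (fun _ => v)

/-- A linear form `f` on `V` induces the additive map `v₁ ⋯ v_d ↦ f v₁ * ⋯ * f v_d` on `S^d V`. -/
def symPowForm (f : Module.Dual ℂ V) : Sym[ℂ]^d V →+ ℂ :=
  AddCon.lift _
    (PiTensorProduct.lift
      ((MultilinearMap.mkPiAlgebra ℂ (Fin d) ℂ).compLinearMap fun _ => f)).toAddMonoidHom
    (AddCon.addConGen_le.2 fun x y h => by
      cases h with
      | perm e g => simpa using (Equiv.prod_comp e fun i => f (g i)).symm)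

theorem symPowForm_symPow (f : Module.Dual ℂ V) (v : V) :
    symPowForm d f (symPow d v) = f v ^ d := by
  change (PiTensorProduct.lift
      ((MultilinearMap.mkPiAlgebra ℂ (Fin d) ℂ).compLinearMap fun _ => f))
        (PiTensorProduct.tprod ℂ fun _ : Fin d => v) = f v ^ d
  simp

theorem symPow_ne_zero {v : V} (hv : v ≠ 0) : symPow d v ≠ 0 := by
  intro h
  obtain ⟨f, hf⟩ : ∃ f : Module.Dual ℂ V, f v ≠ 0 := by
    by_contra! hall
    exact hv ((Module.forall_dual_apply_eq_zero_iff ℂ v).1 hall)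
  have h1 := symPowForm_symPow d f v
  rw [h, map_zero] at h1
  exact pow_ne_zero d hf h1.symm

/-- The Veronese map `v_d : ℙ V → ℙ (S^d V)`, `[v] ↦ [v ^ d]`. -/
def veronese : ℙ ℂ V → ℙ ℂ (Sym[ℂ]^d V) :=
  Projectivization.lift
    (fun v => Projectivization.mk ℂ (symPow d v.1) (symPow_ne_zero d v.2))
    (by
      rintro ⟨a, ha⟩ ⟨b, hb⟩ t h
      obtain rfl : a = t • b := h
      have ht : t ≠ 0 := by
        rintro rfl
        exact ha (zero_smul ℂ b)
      rw [Projectivization.mk_eq_mk_iff']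
      exact ⟨t ^ d, (symPow_smul d t b).symm⟩)

theorem veronese_mk (v : V) (hv : v ≠ 0) :
    veronese d (Projectivization.mk ℂ v hv) =
      Projectivization.mk ℂ (symPow d v) (symPow_ne_zero d hv) :=
  rfl

variable (V) in
/-- The Veronese variety `v_d(ℙ V) ⊆ ℙ (S^d V)`, as a set of points. -/
def veroneseVariety : Set (ℙ ℂ (Sym[ℂ]^d V)) :=
  Set.range (veronese d (V := V))

end Veronese

section Rank

variable {W : Type*} [AddCommGroup W] [Module ℂ W]

/-- The value at `w` of a polynomial function on `W`, written as a polynomial in linear forms. -/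
def polyEval (F : MvPolynomial (Module.Dual ℂ W) ℂ) (w : W) : ℂ :=
  MvPolynomial.eval (fun φ : Module.Dual ℂ W => φ w) F

/-- The Zariski closure of a set of points in `ℙ W`: the common zeros of all homogeneous
polynomials vanishing on the set. -/
def zariskiClosure (S : Set (ℙ ℂ W)) : Set (ℙ ℂ W) :=
  {q | ∀ (n : ℕ) (F : MvPolynomial (Module.Dual ℂ W) ℂ), F.IsHomogeneous n →
    (∀ s ∈ S, polyEval F s.rep = 0) → polyEval F q.rep = 0}

/-- The union of the linear spans `⟨y₁, …, y_r⟩` of `r` points `y_i ∈ X`. -/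
def spannedBy (X : Set (ℙ ℂ W)) (r : ℕ) : Set (ℙ ℂ W) :=
  {q | ∃ y : Fin r → ℙ ℂ W, (∀ i, y i ∈ X) ∧ q ∈ Projectivization.Subspace.span (Set.range y)}

/-- The `r`-th secant variety `σ_r(X)`. -/
def secantVariety (X : Set (ℙ ℂ W)) (r : ℕ) : Set (ℙ ℂ W) :=
  zariskiClosure (spannedBy X r)

/-- The `X`-rank of `p`: the least `r` such that `p` lies in the span of `r` points of `X`
(infinite if `p` is not in the span of `X`). -/
def xRank (X : Set (ℙ ℂ W)) (p : ℙ ℂ W) : ℕ∞ :=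
  ⨅ (r : ℕ) (_ : p ∈ spannedBy X r), (r : ℕ∞)

/-- The `X`-border rank of `p`: the least `r` such that `p ∈ σ_r(X)`. -/
def xBorderRank (X : Set (ℙ ℂ W)) (p : ℙ ℂ W) : ℕ∞ :=
  ⨅ (r : ℕ) (_ : p ∈ secantVariety X r), (r : ℕ∞)

end Rank

end

/-! A product of `d` linear forms on `V` is the value at `v ^ d` of one linear form on `S^d V`.
Given at most `d + 1` pairwise non-proportional nonzero vectors, such a product can vanish at all
but one chosen vector, so their `d`-th powers are linearly independent.

Uniqueness: minimality of `r` makes the vectors in each expression nonzero and pairwise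
non-proportional. Equating two expressions relates `2 * r ≤ d + 1` powers, so every `v' i` must be
proportional to some `v j` (`sum_symPow_unique`).

Border rank: split `d = a + b` with `r ≤ a + 1` and `r ≤ b + 1`. Products of `a` forms and of `b`
forms, both dual to the `v i`, give an `r × r` catalecticant minor. It has rank at most one on each
power, so its determinant vanishes on `σ_s` for `s < r`, yet it is diagonal and invertible at `p`
(`le_of_sum_symPow_mem_secantVariety`). -/

section ProductsOfLinearForms

variable {V : Type*} [AddCommGroup V] [Module ℂ V]

/-- A product of `d` linear forms on `V` is the restriction to `d`-th powers of a linear form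
on `S^d V`. -/
theorem exists_dual_symPow_eq_prod (d : ℕ) (l : Fin d → Module.Dual ℂ V) :
    ∃ Φ : Module.Dual ℂ (Sym[ℂ]^d V), ∀ v, Φ (symPow d v) = ∏ i, l i v := by
  -- Symmetrizing lets the form descend to `S^d V`. On a constant tuple all `d!` terms agree, whence
  -- the factor `(d!)⁻¹` below.
  let m : MultilinearMap ℂ (fun _ : Fin d => V) ℂ :=
    ∑ s : Equiv.Perm (Fin d),
      (MultilinearMap.mkPiAlgebra ℂ (Fin d) ℂ).compLinearMap fun i => l (s i)
  have hm (f : Fin d → V) : m f = ∑ s : Equiv.Perm (Fin d), ∏ i, l (s i) (f i) := by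
    simp [m]
  have hsymm (e : Equiv.Perm (Fin d)) (f : Fin d → V) : m f = m fun i => f (e i) := by
    rw [hm, hm, ← Equiv.sum_comp (Equiv.mulRight e) fun s => ∏ i, l (s i) (f (e i))]
    refine Finset.sum_congr rfl fun s _ => ?_
    simpa using (Equiv.prod_comp e fun i => l (s i) (f i)).symm
  let φ : Sym[ℂ]^d V →+ ℂ :=
    AddCon.lift _ (PiTensorProduct.lift m).toAddMonoidHom
      (AddCon.addConGen_le.2 fun x y h => by
        cases h with
        | perm e g => simpa using hsymm e g)
  let Φ : Module.Dual ℂ (Sym[ℂ]^d V) :=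
    { φ with
      map_smul' := fun c x =>
        AddCon.induction_on x fun t => (PiTensorProduct.lift m).map_smul c t }
  refine ⟨((d.factorial : ℂ)⁻¹) • Φ, fun v => ?_⟩
  have hΦ : Φ (symPow d v) = m fun _ => v :=
    PiTensorProduct.lift.tprod (φ := m) fun _ : Fin d => v
  have hconst (s : Equiv.Perm (Fin d)) : ∏ i, l (s i) v = ∏ i, l i v :=
    Equiv.prod_comp s fun i => l i v
  rw [LinearMap.smul_apply, hΦ, hm]
  simp only [hconst, Finset.sum_const, Finset.card_univ, Fintype.card_perm, Fintype.card_fin,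
    nsmul_eq_mul, smul_eq_mul]
  rw [inv_mul_cancel_left₀ (Nat.cast_ne_zero.2 d.factorial_ne_zero)]

/-- A nonzero vector outside finitely many lines, at most `n` in number, is separated from them
by a product of `n` linear forms. -/
theorem exists_prod_dual_separating {ι : Type*} [Fintype ι] {n : ℕ} (hn : Fintype.card ι ≤ n)
    {u : V} (hu : u ≠ 0) (v : ι → V) (huv : ∀ i, u ∉ Submodule.span ℂ {v i}) :
    ∃ l : Fin n → Module.Dual ℂ V, ∏ j, l j u ≠ 0 ∧ ∀ i, ∏ j, l j (v i) = 0 := by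
  classical
  have hf (i : ι) : ∃ f : Module.Dual ℂ V, f u ≠ 0 ∧ f (v i) = 0 := by
    obtain ⟨f, hfu, hf⟩ := Submodule.exists_dual_map_eq_bot_of_notMem (huv i) inferInstance
    refine ⟨f, hfu, ?_⟩
    have : f (v i) ∈ (Submodule.span ℂ {v i}).map f :=
      Submodule.mem_map_of_mem (Submodule.mem_span_singleton_self _)
    simpa [hf] using this
  choose f hfu hfv using hf
  -- `g` fills the factors left over when there are fewer than `n` lines.
  obtain ⟨g, hg⟩ := Module.Projective.exists_dual_ne_zero ℂ hu
  obtain ⟨e⟩ : Nonempty (ι ↪ Fin n) := Function.Embedding.nonempty_of_card_le (by simpa using hn)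
  refine ⟨Function.extend e f fun _ => g, Finset.prod_ne_zero_iff.2 fun j _ => ?_, fun i => ?_⟩
  · by_cases hj : ∃ i, e i = j
    · obtain ⟨i, rfl⟩ := hj
      rw [e.injective.extend_apply]
      exact hfu i
    · rwa [Function.extend_apply' _ _ _ hj]
  · refine Finset.prod_eq_zero (Finset.mem_univ (e i)) ?_
    rw [e.injective.extend_apply]
    exact hfv i

/-- In a linear relation between at most `d + 1` powers `u i ^ d`, a nonzero vector that is not
a multiple of any of the others has coefficient zero. -/
theorem coeff_eq_zero_of_sum_smul_symPow_eq_zero {ι : Type*} [Fintype ι] {d : ℕ}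
    (hd : Fintype.card ι ≤ d + 1) (u : ι → V) (c : ι → ℂ)
    (h : ∑ i, c i • symPow d (u i) = 0) {k : ι} (hk : u k ≠ 0)
    (hline : ∀ i, i ≠ k → u k ∉ Submodule.span ℂ {u i}) : c k = 0 := by
  classical
  obtain ⟨l, hl, hl0⟩ := exists_prod_dual_separating (ι := {i // i ≠ k}) (n := d)
    (by simpa [Fintype.card_subtype_compl] using hd) hk (fun i => u i) fun i => hline i i.2
  obtain ⟨Φ, hΦ⟩ := exists_dual_symPow_eq_prod d l
  have h1 : ∑ i, c i * ∏ j, l j (u i) = 0 := by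
    simpa [hΦ] using congrArg Φ h
  rw [Finset.sum_eq_single k (fun i _ hi => by simp [hl0 ⟨i, hi⟩]) (by simp)] at h1
  exact (mul_eq_zero.1 h1).resolve_right hl

/-- Two expressions of a vector as a sum of `r ≤ (d + 1) / 2` powers of pairwise non-proportional
nonzero vectors agree up to the order of the summands and `d`-th roots of unity. -/
theorem sum_symPow_unique {d r : ℕ} (hr : 2 * r ≤ d + 1) {v v' : Fin r → V}
    (hv : ∀ i, v i ≠ 0) (hvl : ∀ i j, j ≠ i → v i ∉ Submodule.span ℂ {v j})
    (hv' : ∀ i, v' i ≠ 0) (hvl' : ∀ i j, j ≠ i → v' i ∉ Submodule.span ℂ {v' j})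
    (h : ∑ i, symPow d (v i) = ∑ i, symPow d (v' i)) :
    ∃ (σ : Equiv.Perm (Fin r)) (ζ : Fin r → ℂ), ∀ i, ζ i ^ d = 1 ∧ v' i = ζ i • v (σ i) := by
  have hprop (i : Fin r) : ∃ j, ∃ a : ℂ, a • v j = v' i := by
    by_contra! hne
    have := coeff_eq_zero_of_sum_smul_symPow_eq_zero (d := d) (ι := Fin r ⊕ Fin r)
      (by simpa [two_mul] using hr) (Sum.elim v v') (Sum.elim (fun _ => 1) (fun _ => -1))
      (by simp [h]) (k := Sum.inr i) (hv' i) (by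
        rintro (j | j) hj
        · simpa [Submodule.mem_span_singleton] using hne j
        · exact hvl' i j fun hji => hj (by rw [hji]))
    simp at this
  choose s ζ hs using hprop
  have hinj : Function.Injective s := by
    intro i j hij
    by_contra hne
    refine hvl' i j (Ne.symm hne) ?_
    have hζ : ζ j ≠ 0 := fun h0 => hv' j (by rw [← hs, h0, zero_smul])
    rw [Submodule.mem_span_singleton]
    refine ⟨ζ i * (ζ j)⁻¹, ?_⟩
    rw [← hs i, ← hs j, hij, smul_smul, mul_assoc, inv_mul_cancel₀ hζ, mul_one]
  let σ : Equiv.Perm (Fin r) := Equiv.ofBijective s (Finite.injective_iff_bijective.1 hinj)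
  refine ⟨σ, ζ, fun i => ⟨?_, (hs i).symm⟩⟩
  -- Substituting `v' j = ζ j • v (σ j)` leaves a relation among `r` independent powers.
  have hrel : ∑ j, (ζ j ^ d - 1) • symPow d (v (σ j)) = 0 := by
    have h2 : ∑ j, symPow d (v (σ j)) = ∑ j, symPow d (v j) :=
      Equiv.sum_comp σ fun j => symPow d (v j)
    have h3 (j : Fin r) : ζ j ^ d • symPow d (v (σ j)) = symPow d (v' j) := by
      rw [← symPow_smul]
      exact congrArg _ (hs j)
    simp only [sub_smul, one_smul, Finset.sum_sub_distrib, h2, h3, h, sub_self]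
  exact sub_eq_zero.1 (coeff_eq_zero_of_sum_smul_symPow_eq_zero (by simp; lia)
    (fun j => v (σ j)) _ hrel (hv _) fun j hj => hvl _ _ fun hji => hj (σ.injective hji))

end ProductsOfLinearForms

/-! ### Projective spans, rank and determinantal equations -/

section ProjectiveSpan

variable {W : Type*} [AddCommGroup W] [Module ℂ W]

theorem mk_mem_projectivizationSpan_iff {ι : Type*} (y : ι → W) (hy : ∀ i, y i ≠ 0) {w : W}
    (hw : w ≠ 0) :
    Projectivization.mk ℂ w hw ∈
        Projectivization.Subspace.span (Set.range fun i => Projectivization.mk ℂ (y i) (hy i)) ↔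
      w ∈ Submodule.span ℂ (Set.range y) := by
  constructor
  · intro h
    rw [← Submodule.mk_mem_projectivization_iff _ hw]
    refine (Projectivization.Subspace.mem_span _).1 h _ ?_
    rintro _ ⟨i, rfl⟩
    exact Submodule.subset_span ⟨i, rfl⟩
  · intro h
    rw [← Projectivization.Subspace.mem_submodule_iff _ hw]
    refine Submodule.span_le.2 ?_ h
    rintro _ ⟨i, rfl⟩
    rw [SetLike.mem_coe, Projectivization.Subspace.mem_submodule_iff _ (hy i)]
    exact Projectivization.Subspace.subset_span _ ⟨i, rfl⟩

theorem subset_zariskiClosure (S : Set (ℙ ℂ W)) : S ⊆ zariskiClosure S :=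
  fun q hq _ _ _ hF => hF q hq

theorem xBorderRank_le_xRank (X : Set (ℙ ℂ W)) (p : ℙ ℂ W) : xBorderRank X p ≤ xRank X p :=
  le_iInf₂ fun r hr => iInf₂_le r (subset_zariskiClosure _ hr)

theorem xRank_le_of_mem_spannedBy {X : Set (ℙ ℂ W)} {p : ℙ ℂ W} {r : ℕ}
    (h : p ∈ spannedBy X r) : xRank X p ≤ r :=
  iInf₂_le r h

theorem mem_spannedBy_of_xRank_eq {X : Set (ℙ ℂ W)} {p : ℙ ℂ W} {r : ℕ}
    (h : xRank X p = r) : p ∈ spannedBy X r := by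
  have hlt : xRank X p < ((r + 1 : ℕ) : ℕ∞) := by
    rw [h]
    exact_mod_cast Nat.lt_succ_self r
  simp only [xRank, iInf_lt_iff] at hlt
  obtain ⟨s, hs, hsr⟩ := hlt
  have h1 : s < r + 1 := by exact_mod_cast hsr
  have h2 : r ≤ s := by
    have := xRank_le_of_mem_spannedBy hs
    rw [h] at this
    exact_mod_cast this
  obtain rfl : s = r := by lia
  exact hs

/-- The determinant of a square matrix of linear forms on `W`, as a polynomial function on `W`. -/
noncomputable def detForm {n : ℕ} (Φ : Matrix (Fin n) (Fin n) (Module.Dual ℂ W)) :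
    MvPolynomial (Module.Dual ℂ W) ℂ :=
  (Φ.map MvPolynomial.X).det

theorem detForm_isHomogeneous {n : ℕ} (Φ : Matrix (Fin n) (Fin n) (Module.Dual ℂ W)) :
    (detForm Φ).IsHomogeneous n := by
  rw [detForm, Matrix.det_apply]
  refine MvPolynomial.IsHomogeneous.sum _ _ _ fun s _ => ?_
  have hprod : (∏ i, Φ.map (MvPolynomial.X (R := ℂ)) (s i) i).IsHomogeneous n := by
    simpa using MvPolynomial.IsHomogeneous.prod Finset.univ
      (fun i => Φ.map (MvPolynomial.X (R := ℂ)) (s i) i) (fun _ => 1)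
      fun i _ => MvPolynomial.isHomogeneous_X _ _
  rcases Int.units_eq_one_or (Equiv.Perm.sign s) with hs | hs
  · simpa [hs] using hprod
  · simpa [hs] using hprod.neg

theorem polyEval_detForm {n : ℕ} (Φ : Matrix (Fin n) (Fin n) (Module.Dual ℂ W)) (w : W) :
    polyEval (detForm Φ) w = (Φ.map fun φ => φ w).det := by
  rw [polyEval, detForm, RingHom.map_det]
  congr 1
  ext i j
  simp

theorem det_mul_eq_zero_of_lt {m n : ℕ} (h : m < n) (A : Matrix (Fin n) (Fin m) ℂ)
    (B : Matrix (Fin m) (Fin n) ℂ) : (A * B).det = 0 := by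
  by_contra hne
  have hu : IsUnit (A * B) := (Matrix.isUnit_iff_isUnit_det _).2 (isUnit_iff_ne_zero.2 hne)
  have h1 := Matrix.rank_of_isUnit _ hu
  have h2 := (Matrix.rank_mul_le_left A B).trans A.rank_le_width
  simp at h1
  lia

end ProjectiveSpan

/-! ### Rank and border rank for the Veronese variety -/

section VeroneseRank

variable {V : Type*} [AddCommGroup V] [Module ℂ V]

theorem mk_mem_spannedBy_veroneseVariety_iff {d r : ℕ} {w : Sym[ℂ]^d V} (hw : w ≠ 0) :
    Projectivization.mk ℂ w hw ∈ spannedBy (veroneseVariety d V) r ↔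
      ∃ v : Fin r → V, (∀ i, v i ≠ 0) ∧
        w ∈ Submodule.span ℂ (Set.range fun i => symPow d (v i)) := by
  constructor
  · rintro ⟨y, hy, h⟩
    choose z hz using hy
    refine ⟨fun i => (z i).rep, fun i => (z i).rep_nonzero, ?_⟩
    rw [← mk_mem_projectivizationSpan_iff _ (fun i => symPow_ne_zero d (z i).rep_nonzero) hw]
    convert h using 4 with i
    rw [← hz, ← veronese_mk d _ (z i).rep_nonzero, Projectivization.mk_rep]
  · rintro ⟨v, hv, h⟩
    exact ⟨fun i => Projectivization.mk ℂ (symPow d (v i)) (symPow_ne_zero d (hv i)),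
      fun i => ⟨Projectivization.mk ℂ (v i) (hv i), rfl⟩,
      (mk_mem_projectivizationSpan_iff _ _ hw).2 h⟩

theorem symPow_zero {d : ℕ} (hd : d ≠ 0) : symPow d (0 : V) = 0 := by
  simpa [hd] using symPow_smul d 0 (0 : V)

theorem symPow_mem_span_of_mem_span {d : ℕ} {u v : V} (h : u ∈ Submodule.span ℂ {v}) :
    symPow d u ∈ Submodule.span ℂ {symPow d v} := by
  obtain ⟨c, rfl⟩ := Submodule.mem_span_singleton.1 h
  rw [symPow_smul]
  exact Submodule.smul_mem _ _ (Submodule.mem_span_singleton_self _)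

/-- Counting a finite set allows summands to be dropped. Zero vectors give no point of the variety
and are discarded, which is harmless because `0 ^ d = 0` for `d ≠ 0`. -/
theorem xRank_veroneseVariety_le_card {d : ℕ} (hd : d ≠ 0) {w : Sym[ℂ]^d V} (hw : w ≠ 0)
    (S : Finset V) (h : w ∈ Submodule.span ℂ (symPow d '' (S : Set V))) :
    xRank (veroneseVariety d V) (Projectivization.mk ℂ w hw) ≤ S.card := by
  classical
  have hmem : Projectivization.mk ℂ w hw ∈
      spannedBy (veroneseVariety d V) (S.filter (· ≠ 0)).card := by
    refine (mk_mem_spannedBy_veroneseVariety_iff hw).2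
      ⟨fun i => (S.filter (· ≠ 0)).equivFin.symm i,
        fun i => (Finset.mem_filter.1 ((S.filter (· ≠ 0)).equivFin.symm i).2).2, ?_⟩
    refine Submodule.span_le.2 ?_ h
    rintro _ ⟨u, hu, rfl⟩
    by_cases hu0 : u = 0
    · rw [hu0, symPow_zero hd]
      exact Submodule.zero_mem _
    · refine Submodule.subset_span ⟨(S.filter (· ≠ 0)).equivFin
        ⟨u, Finset.mem_filter.2 ⟨hu, hu0⟩⟩, ?_⟩
      simp
  exact (xRank_le_of_mem_spannedBy hmem).trans (by exact_mod_cast Finset.card_filter_le _ _)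

/-- In an expression of `w` as a sum of `r` powers, where `r` is the rank, no summand lies in the
span of the others. -/
theorem symPow_notMem_span_of_xRank_eq {d r : ℕ} (hd : d ≠ 0) {w : Sym[ℂ]^d V} (hw : w ≠ 0)
    (hr : xRank (veroneseVariety d V) (Projectivization.mk ℂ w hw) = r) {v : Fin r → V}
    (h : ∑ i, symPow d (v i) = w) (i : Fin r) :
    symPow d (v i) ∉ Submodule.span ℂ ((fun j => symPow d (v j)) '' {i}ᶜ) := by
  classical
  intro hi
  have hle := xRank_veroneseVariety_le_card hd hw ((Finset.univ.erase i).image v) (by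
    rw [← h]
    refine Submodule.sum_mem _ fun k _ => ?_
    have himage : symPow d '' (((Finset.univ.erase i).image v : Finset V) : Set V) =
        (fun j => symPow d (v j)) '' {i}ᶜ := by
      ext x
      simp
    rw [himage]
    by_cases hk : k = i
    · rwa [hk]
    · exact Submodule.subset_span ⟨k, hk, rfl⟩)
  rw [hr] at hle
  have h1 : r ≤ ((Finset.univ.erase i).image v).card := by exact_mod_cast hle
  have h2 := h1.trans Finset.card_image_le
  rw [Finset.card_erase_of_mem (Finset.mem_univ i), Finset.card_univ, Fintype.card_fin] at h2
  have := i.pos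
  lia

theorem ne_zero_of_xRank_eq {d r : ℕ} (hd : d ≠ 0) {w : Sym[ℂ]^d V} (hw : w ≠ 0)
    (hr : xRank (veroneseVariety d V) (Projectivization.mk ℂ w hw) = r) {v : Fin r → V}
    (h : ∑ i, symPow d (v i) = w) (i : Fin r) : v i ≠ 0 := fun h0 =>
  symPow_notMem_span_of_xRank_eq hd hw hr h i (by
    rw [h0, symPow_zero hd]
    exact Submodule.zero_mem _)

theorem notMem_span_singleton_of_xRank_eq {d r : ℕ} (hd : d ≠ 0) {w : Sym[ℂ]^d V} (hw : w ≠ 0)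
    (hr : xRank (veroneseVariety d V) (Projectivization.mk ℂ w hw) = r) {v : Fin r → V}
    (h : ∑ i, symPow d (v i) = w) (i j : Fin r) (hj : j ≠ i) :
    v i ∉ Submodule.span ℂ {v j} := fun hij =>
  symPow_notMem_span_of_xRank_eq hd hw hr h i
    (Submodule.span_mono (Set.singleton_subset_iff.2 (Set.mem_image_of_mem _ hj))
      (symPow_mem_span_of_mem_span hij))

theorem exists_sum_symPow_of_mem_spannedBy {d r : ℕ} (hd : d ≠ 0) {w : Sym[ℂ]^d V} (hw : w ≠ 0)
    (h : Projectivization.mk ℂ w hw ∈ spannedBy (veroneseVariety d V) r) :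
    ∃ v : Fin r → V, ∑ i, symPow d (v i) = w := by
  obtain ⟨v, -, hv⟩ := (mk_mem_spannedBy_veroneseVariety_iff hw).1 h
  obtain ⟨c, rfl⟩ := (Submodule.mem_span_range_iff_exists_fun ℂ).1 hv
  -- Coefficients are absorbed into the vectors by taking `d`-th roots.
  choose t ht using fun i => IsAlgClosed.exists_pow_nat_eq (c i) (Nat.pos_of_ne_zero hd)
  exact ⟨fun i => t i • v i, by simp [symPow_smul, ht]⟩

/-- A sum of `r` powers of pairwise non-proportional nonzero vectors has border rank at least `r`,
if `r ≤ (d + 1) / 2`: some `r × r` minor of a catalecticant matrix does not vanish. -/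
theorem le_of_sum_symPow_mem_secantVariety {d r s : ℕ} (hr : 2 * r ≤ d + 1) {v : Fin r → V}
    (hv : ∀ i, v i ≠ 0) (hvl : ∀ i j, j ≠ i → v i ∉ Submodule.span ℂ {v j})
    {p : ℙ ℂ (Sym[ℂ]^d V)} (hp : ∑ i, symPow d (v i) = p.rep)
    (h : p ∈ secantVariety (veroneseVariety d V) s) : r ≤ s := by
  classical
  by_contra! hsr
  -- Each half must have degree at least `r - 1`, to separate one `v i` from the others.
  obtain ⟨a, b, rfl, ha, hb⟩ : ∃ a b, d = a + b ∧ r ≤ a + 1 ∧ r ≤ b + 1 :=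
    ⟨d / 2, d - d / 2, by lia, by lia, by lia⟩
  have hsep {n : ℕ} (hn : r ≤ n + 1) (i : Fin r) : ∃ l : Fin n → Module.Dual ℂ V,
      ∏ k, l k (v i) ≠ 0 ∧ ∀ j, j ≠ i → ∏ k, l k (v j) = 0 := by
    obtain ⟨l, hl, hl0⟩ := exists_prod_dual_separating (ι := {j // j ≠ i}) (n := n)
      (by simpa [Fintype.card_subtype_compl] using hn) (hv i) (fun j => v j)
      fun j => hvl i j j.2
    exact ⟨l, hl, fun j hj => hl0 ⟨j, hj⟩⟩
  choose l hl hl0 using hsep ha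
  choose m hm hm0 using hsep hb
  choose Φ hΦ using fun i j => exists_dual_symPow_eq_prod (a + b) (Fin.append (l i) (m j))
  have hΦ' (i j : Fin r) (u : V) :
      Φ i j (symPow (a + b) u) = (∏ k, l i k u) * ∏ k, m j k u := by
    simp [hΦ, Fin.prod_univ_add]
  have hzero := h r (detForm (Matrix.of Φ)) (detForm_isHomogeneous _) (by
    intro q hq
    rw [← q.mk_rep, mk_mem_spannedBy_veroneseVariety_iff] at hq
    obtain ⟨u, -, hu⟩ := hq
    obtain ⟨c, hc⟩ := (Submodule.mem_span_range_iff_exists_fun ℂ).1 hu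
    rw [polyEval_detForm]
    -- On a combination of `s` powers the matrix factors through `ℂ ^ s`.
    convert det_mul_eq_zero_of_lt hsr (Matrix.of fun i k => c k * ∏ t, l i t (u k))
      (Matrix.of fun k j => ∏ t, m j t (u k))
    ext i j
    simp [← hc, hΦ', Matrix.mul_apply, mul_assoc])
  rw [polyEval_detForm] at hzero
  have hdiag : ((Matrix.of Φ).map fun φ => φ p.rep) =
      Matrix.diagonal fun i => (∏ k, l i k (v i)) * ∏ k, m i k (v i) := by
    ext i j
    rw [Matrix.map_apply, Matrix.of_apply, ← hp, map_sum]
    simp only [hΦ']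
    rw [Finset.sum_eq_single i (fun k _ hk => by rw [hl0 i k hk, zero_mul]) (by simp)]
    by_cases hij : i = j
    · subst hij
      simp
    · rw [hm0 j i hij, mul_zero, Matrix.diagonal_apply_ne _ hij]
  rw [hdiag, Matrix.det_diagonal] at hzero
  exact Finset.prod_ne_zero_iff.2 (fun i _ => mul_ne_zero (hl i) (hm i)) hzero

end VeroneseRank

theorem theorem1p9 {V : Type*} [AddCommGroup V] [Module ℂ V] [FiniteDimensional ℂ V]
    (d : ℕ) (p : ℙ ℂ (Sym[ℂ]^d V))
    (hp : 2 * xRank (veroneseVariety d V) p ≤ (d : ℕ∞) + 1) :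
    xRank (veroneseVariety d V) p = xBorderRank (veroneseVariety d V) p ∧
    ∃ r : ℕ, xRank (veroneseVariety d V) p = (r : ℕ∞) ∧
      ∀ (w : Sym[ℂ]^d V) (hw : w ≠ 0), Projectivization.mk ℂ w hw = p →
        (∃ v : Fin r → V, ∑ i, symPow d (v i) = w) ∧
        ∀ v v' : Fin r → V, ∑ i, symPow d (v i) = w → ∑ i, symPow d (v' i) = w →
          ∃ (σ : Equiv.Perm (Fin r)) (ζ : Fin r → ℂ),
            ∀ i, ζ i ^ d = 1 ∧ v' i = ζ i • v (σ i) := by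
  obtain ⟨r, hr⟩ : ∃ r : ℕ, xRank (veroneseVariety d V) p = r := by
    refine ENat.ne_top_iff_exists.1 (fun htop => ?_) |>.imp fun _ => Eq.symm
    rw [htop, ENat.mul_top (by simp)] at hp
    exact absurd (top_le_iff.1 hp) (by exact_mod_cast ENat.natCast_ne_top (d + 1))
  have hrd : 2 * r ≤ d + 1 := by
    rw [hr] at hp
    exact_mod_cast hp
  have hspan := mem_spannedBy_of_xRank_eq hr
  -- For `d = 0` the bound forces `r = 0`, but the empty span contains no point.
  have hd : d ≠ 0 := by
    rintro rfl
    obtain rfl : r = 0 := by lia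
    rw [← p.mk_rep, mk_mem_spannedBy_veroneseVariety_iff] at hspan
    obtain ⟨v, -, hv⟩ := hspan
    exact p.rep_nonzero (by simpa using hv)
  refine ⟨le_antisymm ?_ (xBorderRank_le_xRank _ _), r, hr, ?_⟩
  · rw [hr]
    rw [← p.mk_rep] at hspan hr
    obtain ⟨v, hv⟩ := exists_sum_symPow_of_mem_spannedBy hd p.rep_nonzero hspan
    refine le_iInf₂ fun s hs => ?_
    exact_mod_cast le_of_sum_symPow_mem_secantVariety hrd
      (ne_zero_of_xRank_eq hd p.rep_nonzero hr hv)
      (notMem_span_singleton_of_xRank_eq hd p.rep_nonzero hr hv) hv hs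
  · rintro w hw rfl
    exact ⟨exists_sum_symPow_of_mem_spannedBy hd hw hspan, fun v v' h h' =>
      sum_symPow_unique hrd (ne_zero_of_xRank_eq hd hw hr h)
        (notMem_span_singleton_of_xRank_eq hd hw hr h) (ne_zero_of_xRank_eq hd hw hr h')
        (notMem_span_singleton_of_xRank_eq hd hw hr h') (h.trans h'.symm)⟩
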